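/- Given a prime $p$, a link diagram is $p$-colorable if its arcs can be labeled with elements of $\mathbb{Z}/p$ so that more than one label is used and, at each crossing, $2x \equiv y+z \pmod p$, where $x$ is the label of the overarc and $y,z$ are the labels of the two underarcs. A link (a class of link diagrams up to planar isotopy and Reidemeister moves) is $p$-colorable if it has a $p$-colorable diagram. A link is a rainbow ring if it is $p$-colorable for every prime $p$, and nearly invisible if $p=2$ is the only prime for which it is $p$-colorable. For integers $u \ge 0$ and $v \ge 1$, let $T(u,v)$ be the torus link that meets each longitude of the torus $u$ times and each meridian $v$ times, that is, the closure of the braid $(\sigma_1\sigma_2\cdots\sigma_{v-1})^u$ on $v$ strands. Theorem. Let $n > 1$ and $m \ge 0$ be integers such that $mn$ is even, and let $T = T(\frac12 mn, n)$. 1. If $n$ and $\frac12 m$ are both odd, then $T$ is nearly invisible. 2. If $n = 2$, then, for every prime $p$, $T$ is $p$-colorable if and only if $p$ divides $m$. 3. If $n = 4$ and $m$ is odd, then, for every prime $p$, $T$ is $p$-colorable if and only if $p$ divides $2m$. 4. In all other cases $T$ is a rainbow ring. -/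

import Mathlib

/-!
Link diagrams, their equivalence, torus links and `p`-colorings.

A link diagram is placed in the plane in general position with respect to the height, so that
it is cut by horizontal lines into slices, each of which contains exactly one local minimum (cup),
one local maximum (cap) or one crossing, next to vertical strands.  It is recorded as the list
of its slices, read from bottom to top.  Strands are numbered from left to right, from `0`.

A link is an equivalence class of link diagrams under planar isotopy and the Reidemeister moves.
-/

/-- What happens in a slice. In a `slash` crossing the overstrand runs from the bottom left to the
top right (as in the character `/`), in a `backslash` crossing it runs from the bottom right to
the top left. -/
inductive PieceKind
  | cup
  | cap
  | slash
  | backslash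

namespace PieceKind

/-- The number of strands that enter the piece from below. -/
def inn : PieceKind → ℕ
  | cup => 0
  | cap => 2
  | slash => 2
  | backslash => 2

/-- The number of strands that leave the piece at the top. -/
def out : PieceKind → ℕ
  | cup => 2
  | cap => 0
  | slash => 2
  | backslash => 2

end PieceKind

/-- A slice of a diagram: a piece, with `pos` vertical strands to the left of it. -/
structure Piece where
  kind : PieceKind
  pos : ℕ

/-- `IsTangle m w n`: the slices in `w` can be stacked on `m` strands, and `n` strands leave
at the top. -/
def IsTangle : ℕ → List Piece → ℕ → Prop
  | m, [], n => m = n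
  | m, P :: w, n => P.pos + P.kind.inn ≤ m ∧ IsTangle (m - P.kind.inn + P.kind.out) w n

/-- A diagram of a link: no strand enters at the bottom, and none leaves at the top. -/
structure LinkDiagram where
  word : List Piece
  isTangle : IsTangle 0 word 0

/-- The local moves: planar isotopy (the first seven families) and the Reidemeister moves
of type I (four families), II (two) and III (one). -/
inductive LocalMove : List Piece → List Piece → Prop
  /-- Two pieces side by side, with `g` strands between them, exchange heights. -/
  | exchange (P Q : PieceKind) (i g : ℕ) :
      LocalMove [⟨P, i⟩, ⟨Q, i + P.out + g⟩] [⟨Q, i + P.inn + g⟩, ⟨P, i⟩]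
  /-- A strand that makes a zigzag is straightened. -/
  | zigzag_right (i : ℕ) : LocalMove [⟨.cup, i + 1⟩, ⟨.cap, i⟩] []
  | zigzag_left (i : ℕ) : LocalMove [⟨.cup, i⟩, ⟨.cap, i + 1⟩] []
  /-- A strand that crosses one leg of a cap or of a cup is moved to the other leg. -/
  | cap_over (i : ℕ) : LocalMove [⟨.slash, i⟩, ⟨.cap, i + 1⟩] [⟨.backslash, i + 1⟩, ⟨.cap, i⟩]
  | cap_under (i : ℕ) : LocalMove [⟨.backslash, i⟩, ⟨.cap, i + 1⟩] [⟨.slash, i + 1⟩, ⟨.cap, i⟩]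
  | cup_under (i : ℕ) : LocalMove [⟨.cup, i + 1⟩, ⟨.slash, i⟩] [⟨.cup, i⟩, ⟨.backslash, i + 1⟩]
  | cup_over (i : ℕ) : LocalMove [⟨.cup, i + 1⟩, ⟨.backslash, i⟩] [⟨.cup, i⟩, ⟨.slash, i + 1⟩]
  /-- Reidemeister I. -/
  | cap_slash (i : ℕ) : LocalMove [⟨.slash, i⟩, ⟨.cap, i⟩] [⟨.cap, i⟩]
  | cap_backslash (i : ℕ) : LocalMove [⟨.backslash, i⟩, ⟨.cap, i⟩] [⟨.cap, i⟩]
  | cup_slash (i : ℕ) : LocalMove [⟨.cup, i⟩, ⟨.slash, i⟩] [⟨.cup, i⟩]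
  | cup_backslash (i : ℕ) : LocalMove [⟨.cup, i⟩, ⟨.backslash, i⟩] [⟨.cup, i⟩]
  /-- Reidemeister II. -/
  | slash_backslash (i : ℕ) : LocalMove [⟨.slash, i⟩, ⟨.backslash, i⟩] []
  | backslash_slash (i : ℕ) : LocalMove [⟨.backslash, i⟩, ⟨.slash, i⟩] []
  /-- Reidemeister III. -/
  | braid (i : ℕ) : LocalMove [⟨.slash, i⟩, ⟨.slash, i + 1⟩, ⟨.slash, i⟩]
      [⟨.slash, i + 1⟩, ⟨.slash, i⟩, ⟨.slash, i + 1⟩]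

/-- Two link diagrams differ by one local move. -/
def LinkDiagram.Move (D E : LinkDiagram) : Prop :=
  ∃ u s t v : List Piece, LocalMove s t ∧ D.word = u ++ s ++ v ∧ E.word = u ++ t ++ v

/-- A link: a class of the equivalence relation that the moves generate on link diagrams. -/
def Link : Type := Quot LinkDiagram.Move

/-- The link that a diagram represents. -/
def LinkDiagram.toLink (D : LinkDiagram) : Link := Quot.mk _ D

/-- `P.Colors l l'`: if the strands below the slice `P` have the colors `l` and the strands above
it the colors `l'`, both from left to right, then each arc in the slice has only one color and, at
a crossing, `2 x = y + z` for the color `x` of the overarc and the colors `y`, `z` of the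
underarcs. -/
def Piece.Colors {p : ℕ} (P : Piece) (l l' : List (ZMod p)) : Prop :=
  ∃ a b : List (ZMod p), a.length = P.pos ∧
    match P.kind with
    | .cup => ∃ x, l = a ++ b ∧ l' = a ++ [x, x] ++ b
    | .cap => ∃ x, l = a ++ [x, x] ++ b ∧ l' = a ++ b
    | .slash => ∃ x y z, 2 * x = y + z ∧ l = a ++ [x, y] ++ b ∧ l' = a ++ [z, x] ++ b
    | .backslash => ∃ x y z, 2 * x = y + z ∧ l = a ++ [y, x] ++ b ∧ l' = a ++ [x, z] ++ b

/-- `IsColoring w l ls`: a labeling of the arcs of `w` by colors that satisfies the equation at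
each crossing, where `l` lists the colors of the strands at the bottom and `ls` the lists
of the colors of the strands above the first slice, above the second slice, and so on. -/
def IsColoring {p : ℕ} : List Piece → List (ZMod p) → List (List (ZMod p)) → Prop
  | [], _, ls => ls = []
  | _ :: _, _, [] => False
  | P :: w, l, l' :: ls => P.Colors l l' ∧ IsColoring w l' ls

/-- A diagram is `p`-colorable if its arcs have a labeling as above that uses more than
one color. -/
def LinkDiagram.IsColorable (D : LinkDiagram) (p : ℕ) : Prop :=
  ∃ ls : List (List (ZMod p)), IsColoring D.word [] ls ∧
    ∃ x ∈ ls.flatten, ∃ y ∈ ls.flatten, x ≠ y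

namespace Link

/-- A link is `p`-colorable if it has a `p`-colorable diagram. -/
def IsColorable (L : Link) (p : ℕ) : Prop :=
  ∃ D : LinkDiagram, D.toLink = L ∧ D.IsColorable p

/-- A rainbow ring is `p`-colorable for every prime `p`. -/
def IsRainbowRing (L : Link) : Prop :=
  ∀ p : ℕ, p.Prime → L.IsColorable p

/-- A link is nearly invisible if `2` is the only prime `p` for which it is `p`-colorable. -/
def IsNearlyInvisible (L : Link) : Prop :=
  ∀ p : ℕ, p.Prime → (L.IsColorable p ↔ p = 2)

end Link

/-- `v` nested local minima. From left to right, `2 * v` strands leave at the top; the strands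
`j` and `2 * v - 1 - j` belong to the same minimum. -/
def nestedCups (v : ℕ) : List Piece := (List.range v).map fun i => ⟨.cup, i⟩

/-- `v` nested local maxima on `2 * v` strands. -/
def nestedCaps (v : ℕ) : List Piece := (List.range v).reverse.map fun i => ⟨.cap, i⟩

/-- The leftmost of `v` strands passes over all the others and becomes the rightmost one. -/
def torusPattern (v : ℕ) : List Piece := (List.range (v - 1)).map fun i => ⟨.slash, i⟩

/-- The torus link diagram: `u` copies of the pattern on `v` strands, stacked, and then closed up
by joining the `v` ends at the top with the `v` ends at the bottom, around the right. -/
def torusWord (u v : ℕ) : List Piece :=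
  nestedCups v ++ (List.replicate u (torusPattern v)).flatten ++ nestedCaps v

theorem IsTangle.append {m n k : ℕ} {w w' : List Piece} (h : IsTangle m w n)
    (h' : IsTangle n w' k) : IsTangle m (w ++ w') k := by
  induction w generalizing m with
  | nil => simp only [IsTangle] at h; subst h; exact h'
  | cons P w ih => exact ⟨h.1, ih h.2⟩

theorem isTangle_nestedCups (v : ℕ) : IsTangle 0 (nestedCups v) (2 * v) := by
  induction v with
  | zero => rfl
  | succ v ih =>
    simp only [nestedCups, List.range_succ, List.map_append] at ih ⊢
    refine ih.append ?_
    simp only [List.map_cons, List.map_nil, IsTangle, PieceKind.inn, PieceKind.out]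
    omega

theorem isTangle_nestedCaps (v : ℕ) : IsTangle (2 * v) (nestedCaps v) 0 := by
  induction v with
  | zero => rfl
  | succ v ih =>
    simp only [nestedCaps, List.range_succ, List.reverse_append, List.reverse_cons,
      List.reverse_nil, List.nil_append, List.cons_append, List.map_cons] at ih ⊢
    refine ⟨?_, ?_⟩
    · simp only [PieceKind.inn]; omega
    · simpa only [PieceKind.inn, PieceKind.out, Nat.mul_add, Nat.mul_one, Nat.add_sub_cancel,
        Nat.add_zero] using ih

theorem isTangle_slashes (n : ℕ) (s : List ℕ) (hs : ∀ i ∈ s, i + 2 ≤ n) :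
    IsTangle n (s.map fun i => ⟨.slash, i⟩) n := by
  induction s with
  | nil => rfl
  | cons i s ih =>
    have hi := hs i (by simp)
    refine ⟨hi, ?_⟩
    have e : n - PieceKind.slash.inn + PieceKind.slash.out = n := by
      simp only [PieceKind.inn, PieceKind.out]; omega
    simp only [e]
    exact ih fun j hj => hs j (by simp [hj])

theorem isTangle_torusWord (u v : ℕ) : IsTangle 0 (torusWord u v) 0 := by
  refine ((isTangle_nestedCups v).append ?_).append (isTangle_nestedCaps v)
  induction u with
  | zero => rfl
  | succ u ih =>
    simp only [List.replicate_succ, List.flatten_cons]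
    refine IsTangle.append (isTangle_slashes _ _ fun i hi => ?_) ih
    have := List.mem_range.1 hi
    omega

/-- For `0 < v`, the torus link `T(u, v)`, which lies on a torus and meets each longitude `u` times
and each meridian `v` times: `v` strands run around the torus, and on one turn around the
axis of the torus they are rotated about its core by `u / v` of a full turn.  Each pattern stands
for one `v`-th of a full turn. -/
def torusLink (u v : ℕ) : Link :=
  LinkDiagram.toLink ⟨torusWord u v, isTangle_torusWord u v⟩

/-!
Colorability of a diagram is invariant under the local moves: each side of a move, read as
a relation between the colors of the strands below it and above it, is the same relation
(`LocalMove.joins_iff`), and neither side hides a color that is not seen at its ends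
(`LocalMove.const`), so that nonconstant colorings correspond to nonconstant colorings. Hence the
colorability of a torus link can be read off its standard diagram
(`LinkDiagram.isColorable_toLink`).

In that diagram, the nested minima and maxima say that the colors `x 0, …, x (v - 1)` of
the strands below the `u` patterns are equal to those above. Let `x` have period `v`. One pattern
replaces `x j` by `2 * x 0 - x (j + 1)`, that is, it shifts the sequence and applies the reflection
in `x 0`. Conjugating reflections, `u` patterns shift by `u` and apply the product of
the reflections in `x 0, …, x (u - 1)`, which is `y ↦ 2 * S + (-1) ^ u * y` for the alternating sum
`S = x 0 - x 1 + ⋯ ± x (u - 1)`. So a coloring is a periodic sequence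
with `2 * S + (-1) ^ u * x (j + u) = x j` for all `j` (`torusLink_isColorable_iff`).

For `u = m * n / 2` and `v = n`, the shift by `u` is trivial or by half a period. If `u` and `n`
are odd, the condition reads `2 * x j = 2 * S`, which forces `x` to be constant unless `p = 2`. For
`n = 2` and for `n = 4` with `m` odd, it is a small linear system. In the other cases there is
room for a nonconstant sequence whose alternating sums over blocks vanish, namely `1, 1, 0, …, 0`
repeated with signs (`exists_altSum_eq_zero`), or, if `n` is odd and `m / 2` is even, the sums
over successive turns cancel for every sequence.
-/

/-! ### Evaluating slices on lists of colors -/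

namespace Piece

variable {p : ℕ}

theorem colors_slash_zero {x y : ZMod p} {r l' : List (ZMod p)} :
    Colors ⟨.slash, 0⟩ (x :: y :: r) l' ↔ l' = (2 * x - y) :: x :: r := by
  constructor
  · rintro ⟨a, b, ha, x', y', z', h, h1, rfl⟩
    obtain rfl := List.length_eq_zero_iff.1 ha
    simp only [List.nil_append, List.cons_append, List.cons.injEq] at h1 ⊢
    obtain ⟨rfl, rfl, rfl⟩ := h1
    exact ⟨by rw [h]; ring, rfl, rfl⟩
  · rintro rfl
    exact ⟨[], r, rfl, x, y, 2 * x - y, by ring, rfl, rfl⟩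

theorem colors_backslash_zero {x y : ZMod p} {r l' : List (ZMod p)} :
    Colors ⟨.backslash, 0⟩ (y :: x :: r) l' ↔ l' = x :: (2 * x - y) :: r := by
  constructor
  · rintro ⟨a, b, ha, x', y', z', h, h1, rfl⟩
    obtain rfl := List.length_eq_zero_iff.1 ha
    simp only [List.nil_append, List.cons_append, List.cons.injEq] at h1 ⊢
    obtain ⟨rfl, rfl, rfl⟩ := h1
    exact ⟨rfl, by rw [h]; ring, rfl⟩
  · rintro rfl
    exact ⟨[], r, rfl, x, y, 2 * x - y, by ring, rfl, rfl⟩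

theorem colors_cup_zero {r l' : List (ZMod p)} :
    Colors ⟨.cup, 0⟩ r l' ↔ ∃ x, l' = x :: x :: r := by
  constructor
  · rintro ⟨a, b, ha, x, rfl, rfl⟩
    obtain rfl := List.length_eq_zero_iff.1 ha
    exact ⟨x, rfl⟩
  · rintro ⟨x, rfl⟩
    exact ⟨[], r, rfl, x, rfl, rfl⟩

theorem colors_cap_zero {x y : ZMod p} {r l' : List (ZMod p)} :
    Colors ⟨.cap, 0⟩ (x :: y :: r) l' ↔ x = y ∧ l' = r := by
  constructor
  · rintro ⟨a, b, ha, x', h1, rfl⟩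
    obtain rfl := List.length_eq_zero_iff.1 ha
    simp only [List.nil_append, List.cons_append, List.cons.injEq] at h1 ⊢
    exact ⟨h1.1.trans h1.2.1.symm, h1.2.2.symm⟩
  · rintro ⟨rfl, rfl⟩
    exact ⟨[], l', rfl, x, rfl, rfl⟩

/-- `PieceKind.Acts K c d`: a piece of kind `K` can have the colors `c` below and `d` above,
vertical strands next to it not being listed. -/
def _root_.PieceKind.Acts {p : ℕ} : PieceKind → List (ZMod p) → List (ZMod p) → Prop
  | .cup, c, d => ∃ x, c = [] ∧ d = [x, x]
  | .cap, c, d => ∃ x, c = [x, x] ∧ d = []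
  | .slash, c, d => ∃ x y z, 2 * x = y + z ∧ c = [x, y] ∧ d = [z, x]
  | .backslash, c, d => ∃ x y z, 2 * x = y + z ∧ c = [y, x] ∧ d = [x, z]

theorem _root_.PieceKind.Acts.length_left {K : PieceKind} {c d : List (ZMod p)}
    (h : K.Acts c d) : c.length = K.inn := by
  cases K
  · obtain ⟨x, rfl, rfl⟩ := h; rfl
  · obtain ⟨x, rfl, rfl⟩ := h; rfl
  · obtain ⟨x, y, z, -, rfl, rfl⟩ := h; rfl
  · obtain ⟨x, y, z, -, rfl, rfl⟩ := h; rfl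

theorem _root_.PieceKind.Acts.length_right {K : PieceKind} {c d : List (ZMod p)}
    (h : K.Acts c d) : d.length = K.out := by
  cases K
  · obtain ⟨x, rfl, rfl⟩ := h; rfl
  · obtain ⟨x, rfl, rfl⟩ := h; rfl
  · obtain ⟨x, y, z, -, rfl, rfl⟩ := h; rfl
  · obtain ⟨x, y, z, -, rfl, rfl⟩ := h; rfl

theorem colors_iff_acts {K : PieceKind} {i : ℕ} {l l' : List (ZMod p)} :
    Colors ⟨K, i⟩ l l' ↔
      ∃ a c d b, a.length = i ∧ K.Acts c d ∧ l = a ++ c ++ b ∧ l' = a ++ d ++ b := by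
  constructor
  · cases K
    · rintro ⟨a, b, ha, x, rfl, rfl⟩
      exact ⟨a, [], [x, x], b, ha, ⟨x, rfl, rfl⟩, by simp, rfl⟩
    · rintro ⟨a, b, ha, x, rfl, rfl⟩
      exact ⟨a, [x, x], [], b, ha, ⟨x, rfl, rfl⟩, rfl, by simp⟩
    · rintro ⟨a, b, ha, x, y, z, h, rfl, rfl⟩
      exact ⟨a, [x, y], [z, x], b, ha, ⟨x, y, z, h, rfl, rfl⟩, rfl, rfl⟩
    · rintro ⟨a, b, ha, x, y, z, h, rfl, rfl⟩
      exact ⟨a, [y, x], [x, z], b, ha, ⟨x, y, z, h, rfl, rfl⟩, rfl, rfl⟩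
  · rintro ⟨a, c, d, b, ha, h, rfl, rfl⟩
    refine ⟨a, b, ha, ?_⟩
    cases K
    · obtain ⟨x, rfl, rfl⟩ := h; exact ⟨x, by simp, rfl⟩
    · obtain ⟨x, rfl, rfl⟩ := h; exact ⟨x, rfl, by simp⟩
    · obtain ⟨x, y, z, h, rfl, rfl⟩ := h; exact ⟨x, y, z, h, rfl, rfl⟩
    · obtain ⟨x, y, z, h, rfl, rfl⟩ := h; exact ⟨x, y, z, h, rfl, rfl⟩

theorem colors_add {K : PieceKind} {i j : ℕ} {a r l' : List (ZMod p)} (ha : a.length = i) :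
    Colors ⟨K, i + j⟩ (a ++ r) l' ↔ ∃ r', l' = a ++ r' ∧ Colors ⟨K, j⟩ r r' := by
  simp only [colors_iff_acts]
  constructor
  · rintro ⟨a', c, d, b, ha', h, h1, rfl⟩
    obtain ⟨a₁, a₂, rfl, h1₁, rfl⟩ : ∃ a₁ a₂, a' = a₁ ++ a₂ ∧ a₁.length = i ∧ a₁ = a := by
      refine ⟨a'.take i, a'.drop i, by simp, by simp; omega, ?_⟩
      have := congrArg (List.take i) h1
      simpa [List.take_append, ← ha, show a.length - a'.length = 0 by omega] using this.symm
    simp only [List.append_assoc, List.append_cancel_left_eq] at h1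
    exact ⟨a₂ ++ d ++ b, by simp, a₂, c, d, b, by simp at ha'; omega, h, by simpa using h1, rfl⟩
  · rintro ⟨_, rfl, a', c, d, b, ha', h, rfl, rfl⟩
    exact ⟨a ++ a', c, d, b, by simp [ha, ha'], h, by simp, by simp⟩

theorem colors_length {K : PieceKind} {i : ℕ} {a r l' : List (ZMod p)} (ha : a.length = i) :
    Colors ⟨K, i⟩ (a ++ r) l' ↔ ∃ r', l' = a ++ r' ∧ Colors ⟨K, 0⟩ r r' :=
  colors_add (j := 0) ha

theorem colors_one_cons {K : PieceKind} {x : ZMod p} {r l' : List (ZMod p)} :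
    Colors ⟨K, 1⟩ (x :: r) l' ↔ ∃ r', l' = x :: r' ∧ Colors ⟨K, 0⟩ r r' :=
  colors_length (a := [x]) rfl

theorem Colors.length_eq {P : Piece} {l l' : List (ZMod p)} (h : P.Colors l l') :
    l'.length = l.length - P.kind.inn + P.kind.out := by
  obtain ⟨a, c, d, b, -, hP, rfl, rfl⟩ := colors_iff_acts.1 h
  have h1 := hP.length_left
  have h2 := hP.length_right
  simp only [List.length_append]
  omega

/-- A slice other than a local minimum has no colors above it that it does not have below,
if the latter are all equal. -/
theorem Colors.const_up {P : Piece} {l l' : List (ZMod p)} {c : ZMod p} (h : P.Colors l l')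
    (hP : P.kind ≠ .cup) (hl : ∀ x ∈ l, x = c) : ∀ x ∈ l', x = c := by
  obtain ⟨K, i⟩ := P
  cases K
  · exact absurd rfl hP
  · obtain ⟨a, b, -, x, rfl, rfl⟩ := h
    intro y hy
    exact hl y (by simp at hy ⊢; tauto)
  all_goals
    obtain ⟨a, b, -, x, y, z, h, rfl, rfl⟩ := h
    have hx := hl x (by simp)
    have hy := hl y (by simp)
    have hz : z = c := by linear_combination 2 * hx - hy - h
    intro w hw
    simp only [List.mem_append, List.mem_cons, List.not_mem_nil, or_false] at hw
    rcases hw with (hw | hw | hw) | hw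
    · exact hl w (by simp [hw])
    · simp only [hw, hx, hz]
    · simp only [hw, hx, hz]
    · exact hl w (by simp [hw])

/-- A slice other than a local maximum has no colors below it that it does not have above,
if the latter are all equal. -/
theorem Colors.const_down {P : Piece} {l l' : List (ZMod p)} {c : ZMod p} (h : P.Colors l l')
    (hP : P.kind ≠ .cap) (hl : ∀ x ∈ l', x = c) : ∀ x ∈ l, x = c := by
  obtain ⟨K, i⟩ := P
  cases K
  · obtain ⟨a, b, -, x, rfl, rfl⟩ := h
    intro y hy
    exact hl y (by simp at hy ⊢; tauto)
  · exact absurd rfl hP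
  all_goals
    obtain ⟨a, b, -, x, y, z, h, rfl, rfl⟩ := h
    have hx := hl x (by simp)
    have hz := hl z (by simp)
    have hy : y = c := by linear_combination 2 * hx - hz - h
    intro w hw
    simp only [List.mem_append, List.mem_cons, List.not_mem_nil, or_false] at hw
    rcases hw with (hw | hw | hw) | hw
    · exact hl w (by simp [hw])
    · simp only [hw, hx, hy]
    · simp only [hw, hx, hy]
    · exact hl w (by simp [hw])

end Piece

/-! ### Colorings of stacks of slices -/

/-- `Joins w l l'`: some coloring of the slices `w` has the colors `l` at the bottom and `l'`
at the top. -/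
def Joins {p : ℕ} (w : List Piece) (l l' : List (ZMod p)) : Prop :=
  ∃ ls, IsColoring w l ls ∧ ls.getLastD l = l'

section Joins

variable {p : ℕ}

theorem joins_nil {l l' : List (ZMod p)} : Joins [] l l' ↔ l' = l := by
  simp [Joins, IsColoring, eq_comm]

theorem joins_cons {P : Piece} {w : List Piece} {l l' : List (ZMod p)} :
    Joins (P :: w) l l' ↔ ∃ m, P.Colors l m ∧ Joins w m l' := by
  constructor
  · rintro ⟨_ | ⟨m, ls⟩, h, h'⟩
    · exact h.elim
    · exact ⟨m, h.1, ls, h.2, by simpa only [List.getLastD_cons] using h'⟩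
  · rintro ⟨m, h, ls, h1, h2⟩
    exact ⟨m :: ls, ⟨h, h1⟩, by simpa only [List.getLastD_cons] using h2⟩

theorem isColoring_append {w w' : List Piece} {l : List (ZMod p)} {ls : List (List (ZMod p))} :
    IsColoring (w ++ w') l ls ↔ ∃ ls₁ ls₂, ls = ls₁ ++ ls₂ ∧ IsColoring w l ls₁ ∧
      IsColoring w' (ls₁.getLastD l) ls₂ := by
  induction w generalizing l ls with
  | nil => simp [IsColoring]
  | cons P w ih =>
    constructor
    · intro h
      cases ls with
      | nil => exact h.elim
      | cons m ls =>
        obtain ⟨ls₁, ls₂, rfl, h1, h2⟩ := ih.1 h.2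
        exact ⟨m :: ls₁, ls₂, rfl, ⟨h.1, h1⟩, by simpa only [List.getLastD_cons] using h2⟩
    · rintro ⟨_ | ⟨m, ls₁⟩, ls₂, rfl, h1, h2⟩
      · exact h1.elim
      · exact ⟨h1.1, ih.2 ⟨ls₁, ls₂, rfl, h1.2, by simpa only [List.getLastD_cons] using h2⟩⟩

theorem joins_append {w w' : List Piece} {l l' : List (ZMod p)} :
    Joins (w ++ w') l l' ↔ ∃ m, Joins w l m ∧ Joins w' m l' := by
  induction w generalizing l with
  | nil => simp [joins_nil]
  | cons P w ih => simp only [List.cons_append, joins_cons, ih]; tauto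

theorem Joins.length_eq {w : List Piece} {l l' : List (ZMod p)} {n : ℕ} (h : Joins w l l')
    (hw : IsTangle l.length w n) : l'.length = n := by
  induction w generalizing l with
  | nil => rw [joins_nil.1 h]; exact hw
  | cons P w ih =>
    obtain ⟨m, h1, h2⟩ := joins_cons.1 h
    exact ih h2 (h1.length_eq ▸ hw.2)

theorem isTangle_append {m n : ℕ} {w w' : List Piece} :
    IsTangle m (w ++ w') n ↔ ∃ k, IsTangle m w k ∧ IsTangle k w' n := by
  induction w generalizing m with
  | nil => simp [IsTangle]
  | cons P w ih => simp only [List.cons_append, IsTangle, ih]; tauto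

theorem IsColoring.const_up {w : List Piece} {l : List (ZMod p)} {ls : List (List (ZMod p))}
    {c : ZMod p} (h : IsColoring w l ls) (hw : ∀ P ∈ w, P.kind ≠ .cup) (hl : ∀ x ∈ l, x = c) :
    ∀ m ∈ ls, ∀ x ∈ m, x = c := by
  induction w generalizing l ls with
  | nil => simp only [IsColoring] at h; simp [h]
  | cons P w ih =>
    cases ls with
    | nil => exact h.elim
    | cons m ls =>
      have hm := h.1.const_up (hw P (by simp)) hl
      have := ih h.2 (fun Q hQ => hw Q (by simp [hQ])) hm
      exact List.forall_mem_cons.2 ⟨hm, this⟩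

theorem IsColoring.const_down {w : List Piece} {l : List (ZMod p)} {ls : List (List (ZMod p))}
    {c : ZMod p} (h : IsColoring w l ls) (hw : ∀ P ∈ w, P.kind ≠ .cap)
    (hl : ∀ x ∈ ls.getLastD l, x = c) : (∀ x ∈ l, x = c) ∧ ∀ m ∈ ls, ∀ x ∈ m, x = c := by
  induction w generalizing l ls with
  | nil => simp only [IsColoring] at h; subst h; simpa using hl
  | cons P w ih =>
    cases ls with
    | nil => exact h.elim
    | cons m ls =>
      have := ih h.2 (fun Q hQ => hw Q (by simp [hQ])) (by simpa only [List.getLastD_cons] using hl)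
      exact ⟨h.1.const_down (hw P (by simp)) this.1, List.forall_mem_cons.2 this⟩

end Joins

/-! ### Invariance of colorability under the moves -/

section Moves

variable {p : ℕ}

theorem exists_append_of_add_le_length {α : Type*} {l : List α} {i n : ℕ}
    (h : i + n ≤ l.length) : ∃ a c r, a.length = i ∧ c.length = n ∧ l = a ++ (c ++ r) :=
  ⟨l.take i, (l.drop i).take n, (l.drop i).drop n, by simp; omega, by simp; omega, by
    rw [List.take_append_drop, List.take_append_drop]⟩

theorem joins_exchange {P Q : PieceKind} {i g : ℕ} {l l' : List (ZMod p)} :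
    Joins [⟨P, i⟩, ⟨Q, i + P.out + g⟩] l l' ↔ Joins [⟨Q, i + P.inn + g⟩, ⟨P, i⟩] l l' := by
  simp only [joins_cons, joins_nil, Piece.colors_iff_acts]
  constructor
  · rintro ⟨m, ⟨a, c, d, b, ha, hP, rfl, rfl⟩, _, ⟨a', c', d', b', ha', hQ, h, rfl⟩, rfl⟩
    have h1 := hP.length_left
    have h2 := hP.length_right
    have h3 := hQ.length_left
    obtain ⟨e, rfl, rfl⟩ : ∃ e, a' = a ++ d ++ e ∧ b = e ++ c' ++ b' := by
      rw [List.append_assoc a' c'] at h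
      obtain ⟨e, h4, h5⟩ | ⟨e, h4, h5⟩ := List.append_eq_append_iff.1 h
      · exact ⟨e, h4, by simpa using h5⟩
      · have h6 := congrArg List.length h4
        simp only [List.length_append] at h6
        obtain rfl := List.length_eq_zero_iff.1 (show e.length = 0 by omega)
        exact ⟨[], by simpa using h4.symm, by simpa using h5.symm⟩
    simp only [List.length_append] at ha'
    exact ⟨a ++ c ++ e ++ d' ++ b', ⟨a ++ c ++ e, c', d', b', by simp; omega, hQ, by simp, rfl⟩,
      _, ⟨a, c, d, e ++ d' ++ b', ha, hP, by simp, rfl⟩, by simp⟩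
  · rintro ⟨m, ⟨a', c', d', b', ha', hQ, rfl, rfl⟩, _, ⟨a, c, d, b, ha, hP, h, rfl⟩, rfl⟩
    have h1 := hP.length_left
    have h2 := hP.length_right
    have h3 := hQ.length_left
    obtain ⟨e, rfl, rfl⟩ : ∃ e, a' = a ++ c ++ e ∧ b = e ++ d' ++ b' := by
      rw [List.append_assoc a' d'] at h
      obtain ⟨e, h4, h5⟩ | ⟨e, h4, h5⟩ := List.append_eq_append_iff.1 h
      · have h6 := congrArg List.length h4
        simp only [List.length_append] at h6
        obtain rfl := List.length_eq_zero_iff.1 (show e.length = 0 by omega)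
        exact ⟨[], by simpa using h4.symm, by simpa using h5.symm⟩
      · exact ⟨e, h4, by simpa using h5⟩
    simp only [List.length_append] at ha'
    exact ⟨a ++ d ++ e ++ c' ++ b', ⟨a, c, d, e ++ c' ++ b', ha, hP, by simp, by simp⟩,
      _, ⟨a ++ d ++ e, c', d', b', by simp; omega, hQ, by simp, rfl⟩, by simp⟩

/-- The two sides of a local move relate the same colors at the bottom to the same colors
at the top. The hypothesis on the number of strands matters where one side is empty. -/
theorem LocalMove.joins_iff {s t : List Piece} (h : LocalMove s t) {l l' : List (ZMod p)} {k : ℕ}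
    (hs : IsTangle l.length s k) : Joins s l l' ↔ Joins t l l' := by
  cases h with
  | exchange P Q i g => exact joins_exchange
  | cap_over i | cap_under i | braid i =>
    simp only [IsTangle, PieceKind.inn, PieceKind.out] at hs
    obtain ⟨a, c, r, ha, hc, rfl⟩ := exists_append_of_add_le_length (l := l) (i := i) (n := 3)
      (by omega)
    obtain ⟨x, y, z, rfl⟩ := List.length_eq_three.1 hc
    simp only [joins_cons, joins_nil, Piece.colors_add ha, Piece.colors_length ha,
      Piece.colors_one_cons, Piece.colors_slash_zero, Piece.colors_backslash_zero,
      Piece.colors_cap_zero, existsAndEq, and_true, true_and,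
      List.cons_append, List.nil_append]
    first
    | exact and_congr_right fun _ => by constructor <;> intro h <;> linear_combination -h
    | exact and_congr_left fun h => by rw [h]
    | ring_nf
  | cap_slash i | cap_backslash i | slash_backslash i | backslash_slash i =>
    simp only [IsTangle, PieceKind.inn, PieceKind.out] at hs
    obtain ⟨a, c, r, ha, hc, rfl⟩ := exists_append_of_add_le_length (l := l) (i := i) (n := 2)
      (by omega)
    obtain ⟨x, y, rfl⟩ := List.length_eq_two.1 hc
    simp only [joins_cons, joins_nil, Piece.colors_length ha, Piece.colors_slash_zero,
      Piece.colors_backslash_zero, Piece.colors_cap_zero, existsAndEq, and_true, true_and,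
      List.cons_append, List.nil_append, sub_sub_cancel] <;>
    grind
  | zigzag_right i | zigzag_left i | cup_under i | cup_over i =>
    simp only [IsTangle, PieceKind.inn, PieceKind.out] at hs
    obtain ⟨a, c, r, ha, hc, rfl⟩ := exists_append_of_add_le_length (l := l) (i := i) (n := 1)
      (by omega)
    obtain ⟨x, rfl⟩ := List.length_eq_one_iff.1 hc
    simp only [joins_cons, joins_nil, Piece.colors_add ha, Piece.colors_length ha,
      Piece.colors_one_cons, Piece.colors_slash_zero, Piece.colors_backslash_zero,
      Piece.colors_cup_zero, Piece.colors_cap_zero, existsAndEq, and_true, true_and,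
      List.cons_append, List.nil_append] <;>
    -- In the last two families, the color of the minimum is reflected to `2 * x - y`.
    constructor <;> rintro ⟨y, rfl⟩ <;> exact ⟨2 * x - y, by simp only [sub_sub_cancel]⟩
  | cup_slash i | cup_backslash i =>
    simp only [IsTangle, PieceKind.inn, PieceKind.out] at hs
    obtain ⟨a, c, r, ha, hc, rfl⟩ := exists_append_of_add_le_length (l := l) (i := i) (n := 0)
      (by omega)
    obtain rfl := List.length_eq_zero_iff.1 hc
    simp only [joins_cons, joins_nil, Piece.colors_length ha, Piece.colors_slash_zero,
      Piece.colors_backslash_zero, Piece.colors_cup_zero, existsAndEq, and_true, true_and,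
      List.nil_append, two_mul, add_sub_cancel_right]

theorem Piece.Colors.const_of_cup {i : ℕ} {l m : List (ZMod p)} {c : ZMod p}
    (h : Colors ⟨.cup, i⟩ l m) (hl : ∀ x ∈ l, x = c)
    (hm : ∀ a b x, a.length = i → l = a ++ b → m = a ++ x :: x :: b → x = c) :
    ∀ x ∈ m, x = c := by
  obtain ⟨a, b, ha, x, rfl, rfl⟩ := h
  have hx := hm a b x ha rfl (by simp)
  intro y hy
  simp only [List.mem_append, List.mem_cons, List.not_mem_nil, or_false, or_self] at hy hl
  rcases hy with (hy | hy) | hy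
  · exact hl y (Or.inl hy)
  · rw [hy, hx]
  · exact hl y (Or.inr hy)

/-- If the strands at the two ends of one side of a local move all have the same color, then so
have the strands in between: the moves create or remove no closed curve. -/
theorem LocalMove.const {s t w : List Piece} (h : LocalMove s t) (hw : w = s ∨ w = t)
    {l : List (ZMod p)} {ls : List (List (ZMod p))} {c : ZMod p} (hc : IsColoring w l ls)
    (hl : ∀ x ∈ l, x = c) (hl' : ∀ x ∈ ls.getLastD l, x = c) : ∀ m ∈ ls, ∀ x ∈ m, x = c := by
  have pair {P Q : Piece} (hc : IsColoring [P, Q] l ls) (hPQ : P.kind = .cup → Q.kind = .cap →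
      ∀ m l', P.Colors l m → Q.Colors m l' → (∀ x ∈ l', x = c) → ∀ x ∈ m, x = c) :
      ∀ m ∈ ls, ∀ x ∈ m, x = c := by
    obtain _ | ⟨m, _ | ⟨l', _ | ⟨m', ls⟩⟩⟩ := ls
    · exact hc.elim
    · exact hc.2.elim
    · have hl'' : ∀ x ∈ l', x = c := hl'
      have hm : ∀ x ∈ m, x = c := by
        by_cases hP : P.kind = .cup
        · by_cases hQ : Q.kind = .cap
          · exact hPQ hP hQ m l' hc.1 hc.2.1 hl''
          · exact hc.2.1.const_down hQ hl''
        · exact hc.1.const_up hP hl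
      simpa using ⟨hm, hl''⟩
    · exact absurd hc.2.2 (by simp [IsColoring])
  cases h with
  | exchange P Q i g =>
    rcases hw with rfl | rfl
    · refine pair hc ?_
      rintro rfl rfl m l' h1 h2 h3
      refine h1.const_of_cup hl fun a b x ha h4 h5 => ?_
      subst h5
      rw [show a ++ x :: x :: b = (a ++ [x, x]) ++ b by simp] at h2
      obtain ⟨r, rfl, -⟩ := (Piece.colors_add (by simp [ha, PieceKind.out])).1 h2
      exact h3 x (by simp)
    · refine pair hc ?_
      rintro rfl rfl m l' h1 h2 h3
      refine h1.const_of_cup hl fun a b x ha h4 h5 => ?_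
      subst h5
      simp only [PieceKind.inn] at ha
      obtain ⟨a, e, a', rfl, he, rfl⟩ := exists_append_of_add_le_length (l := a) (i := i) (n := 2)
        (by omega)
      obtain ⟨y, z, rfl⟩ := List.length_eq_two.1 he
      simp only [List.append_assoc] at h2
      obtain ⟨r, rfl, h6⟩ := (Piece.colors_length rfl).1 h2
      obtain ⟨-, rfl⟩ := Piece.colors_cap_zero.1 h6
      exact h3 x (by simp)
  | zigzag_right i =>
    rcases hw with rfl | rfl
    · refine pair hc ?_
      rintro - - m l' h1 h2 -
      refine h1.const_of_cup hl fun a b x ha h4 h5 => ?_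
      subst h4 h5
      obtain ⟨a, e, a', rfl, he, rfl⟩ := exists_append_of_add_le_length (l := a) (i := i) (n := 1)
        (by omega)
      obtain ⟨y, rfl⟩ := List.length_eq_one_iff.1 he
      obtain rfl : a' = [] := List.length_eq_zero_iff.1 (by simpa using ha)
      simp only [List.append_assoc] at h2
      obtain ⟨r, rfl, h6⟩ := (Piece.colors_length rfl).1 h2
      rw [← (Piece.colors_cap_zero.1 h6).1]
      exact hl y (by simp)
    · exact hc.const_up (by simp) hl
  | zigzag_left i =>
    rcases hw with rfl | rfl
    · refine pair hc ?_
      rintro - - m l' h1 h2 h3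
      refine h1.const_of_cup hl fun a b x ha h4 h5 => ?_
      subst h4 h5
      obtain ⟨r, rfl, h6⟩ := (Piece.colors_add ha).1 h2
      obtain ⟨r, rfl, -⟩ := Piece.colors_one_cons.1 h6
      exact h3 x (by simp)
    · exact hc.const_up (by simp) hl
  | cup_under | cup_over | cup_slash | cup_backslash =>
    rcases hw with rfl | rfl <;> exact (hc.const_down (by simp) hl').2
  | _ => rcases hw with rfl | rfl <;> exact hc.const_up (by simp) hl

theorem LinkDiagram.isColorable_iff {D : LinkDiagram} :
    D.IsColorable p ↔
      ∃ ls, IsColoring D.word [] ls ∧ ¬ ∃ c : ZMod p, ∀ m ∈ ls, ∀ x ∈ m, x = c := by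
  refine exists_congr fun ls => and_congr_right fun _ => ?_
  constructor
  · rintro ⟨x, hx, y, hy, hxy⟩ ⟨c, hc⟩
    obtain ⟨m, hm, hx⟩ := List.mem_flatten.1 hx
    obtain ⟨m', hm', hy⟩ := List.mem_flatten.1 hy
    exact hxy ((hc m hm x hx).trans (hc m' hm' y hy).symm)
  · intro h
    push Not at h
    obtain ⟨m, hm, x, hx, -⟩ := h 0
    obtain ⟨m', hm', y, hy, hyx⟩ := h x
    exact ⟨y, List.mem_flatten.2 ⟨m', hm', hy⟩, x, List.mem_flatten.2 ⟨m, hm, hx⟩, hyx⟩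

/-- A nonconstant coloring stays nonconstant if a part with constant ends is necessarily constant
and is replaced by a part that connects the same colors. -/
theorem LinkDiagram.IsColorable.replace {D E : LinkDiagram} {u s t v : List Piece} {k : ℕ}
    (hD : D.word = u ++ s ++ v) (hE : E.word = u ++ t ++ v) (hu : IsTangle 0 u k)
    (hst : ∀ l l' : List (ZMod p), l.length = k → Joins s l l' → Joins t l l')
    (hs : ∀ (l : List (ZMod p)) (ls : List (List (ZMod p))) (c : ZMod p), IsColoring s l ls →
      (∀ x ∈ l, x = c) → (∀ x ∈ ls.getLastD l, x = c) → ∀ m ∈ ls, ∀ x ∈ m, x = c)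
    (h : D.IsColorable p) : E.IsColorable p := by
  rw [isColorable_iff] at h ⊢
  obtain ⟨ls, h, hc⟩ := h
  rw [hD, isColoring_append] at h
  obtain ⟨_, lv, rfl, h, hv⟩ := h
  obtain ⟨lu, la, rfl, hlu, ha⟩ := isColoring_append.1 h
  obtain ⟨lb, hb, hab⟩ := hst _ _ (Joins.length_eq ⟨lu, hlu, rfl⟩ hu) ⟨la, ha, rfl⟩
  have last {l₁ l₂ : List (List (ZMod p))} :
      (l₁ ++ l₂).getLastD [] = l₂.getLastD (l₁.getLastD []) := by
    cases l₂ <;> simp [List.getLastD_eq_getLast?, List.getLast?_append, List.getLast?_cons]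
  refine ⟨lu ++ lb ++ lv, ?_, ?_⟩
  · rw [hE, isColoring_append]
    refine ⟨_, _, rfl, isColoring_append.2 ⟨_, _, rfl, hlu, hb⟩, ?_⟩
    rw [last] at hv ⊢
    rwa [hab]
  · rintro ⟨c, h⟩
    have getLastD_const {l : List (ZMod p)} {ls : List (List (ZMod p))} (hl : ∀ x ∈ l, x = c)
        (h : ∀ m ∈ ls, ∀ x ∈ m, x = c) : ∀ x ∈ ls.getLastD l, x = c := by
      rw [List.getLastD_eq_getLast?]
      cases h' : ls.getLast? with
      | none => exact hl
      | some m => exact h m (List.mem_of_getLast? h')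
    simp only [List.mem_append, or_imp, forall_and] at h
    have h1 := getLastD_const (l := []) (by simp) h.1.1
    refine hc ⟨c, ?_⟩
    simp only [List.mem_append, or_imp, forall_and]
    exact ⟨⟨h.1.1, hs _ _ c ha h1 (hab ▸ getLastD_const h1 h.1.2)⟩, h.2⟩

theorem LinkDiagram.Move.isColorable_iff {D E : LinkDiagram} (h : D.Move E) :
    D.IsColorable p ↔ E.IsColorable p := by
  obtain ⟨u, s, t, v, h, hD, hE⟩ := h
  have hT := D.isTangle
  rw [hD, isTangle_append] at hT
  obtain ⟨_, hT, -⟩ := hT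
  obtain ⟨k, hu, hs⟩ := isTangle_append.1 hT
  constructor
  · refine .replace hD hE hu (fun l l' hl => ?_) fun _ _ _ => h.const (.inl rfl)
    subst hl; exact (h.joins_iff hs).1
  · refine .replace hE hD hu (fun l l' hl => ?_) fun _ _ _ => h.const (.inr rfl)
    subst hl; exact (h.joins_iff hs).2

/-- Colorability does not depend on the diagram of a link. -/
theorem LinkDiagram.isColorable_toLink {D : LinkDiagram} :
    D.toLink.IsColorable p ↔ D.IsColorable p := by
  refine ⟨?_, fun h => ⟨D, rfl, h⟩⟩
  rintro ⟨E, hE, h⟩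
  have : ∀ {D E : LinkDiagram}, Relation.EqvGen LinkDiagram.Move D E →
      (D.IsColorable p ↔ E.IsColorable p) := by
    intro D E h
    induction h with
    | rel _ _ h => exact h.isColorable_iff
    | refl => rfl
    | symm _ _ _ ih => exact ih.symm
    | trans _ _ _ _ _ ih ih' => exact ih.trans ih'
  exact (this (Quot.eqvGen_exact hE)).1 h

end Moves

/-! ### Colorings of the torus diagrams -/

section Torus

variable {p : ℕ}

theorem joins_nestedCups {v : ℕ} {l' : List (ZMod p)} :
    Joins (nestedCups v) [] l' ↔ ∃ xs : List (ZMod p), xs.length = v ∧ l' = xs ++ xs.reverse := by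
  induction v generalizing l' with
  | zero => simp [nestedCups, joins_nil]
  | succ v ih =>
    have hv : nestedCups (v + 1) = nestedCups v ++ [⟨.cup, v⟩] := by
      simp [nestedCups, List.range_succ]
    simp only [hv, joins_append, ih, joins_cons, joins_nil]
    constructor
    · rintro ⟨_, ⟨xs, hxs, rfl⟩, m, h, rfl⟩
      obtain ⟨r, rfl, hr⟩ := (Piece.colors_length hxs).1 h
      obtain ⟨x, rfl⟩ := Piece.colors_cup_zero.1 hr
      exact ⟨xs ++ [x], by simp [hxs], by simp⟩
    · rintro ⟨xs, hxs, rfl⟩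
      obtain rfl | ⟨xs, x, rfl⟩ := List.eq_nil_or_concat xs
      · simp at hxs
      · have hxs' : xs.length = v := by simpa using hxs
        exact ⟨_, ⟨xs, hxs', rfl⟩, _,
          (Piece.colors_length hxs').2 ⟨_, rfl, Piece.colors_cup_zero.2 ⟨x, rfl⟩⟩, by simp⟩

theorem joins_nestedCaps {v : ℕ} {xs ys : List (ZMod p)} (hx : xs.length = v)
    (hy : ys.length = v) : Joins (nestedCaps v) (xs ++ ys) [] ↔ ys = xs.reverse := by
  induction v generalizing xs ys with
  | zero =>
    obtain rfl := List.length_eq_zero_iff.1 hx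
    obtain rfl := List.length_eq_zero_iff.1 hy
    simp [nestedCaps, joins_nil]
  | succ v ih =>
    have hv : nestedCaps (v + 1) = ⟨.cap, v⟩ :: nestedCaps v := by
      simp [nestedCaps, List.range_succ]
    obtain ⟨y, ys, rfl⟩ := List.exists_cons_of_length_eq_add_one hy
    obtain rfl | ⟨xs, x, rfl⟩ := List.eq_nil_or_concat xs
    · simp at hx
    · simp only [List.concat_eq_append, List.length_append, List.length_cons, List.length_nil,
        Nat.add_right_cancel_iff] at hx hy
      simp only [List.concat_eq_append, List.append_assoc, hv, joins_cons, Piece.colors_length hx,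
        List.cons_append, List.nil_append, Piece.colors_cap_zero, existsAndEq, and_true, ih hx hy,
        List.reverse_append, List.reverse_cons, List.reverse_nil, List.cons.injEq, true_and]
      tauto

theorem joins_torusPattern {v : ℕ} {x : ZMod p} {xs ys l' : List (ZMod p)}
    (h : xs.length + 1 = v) : Joins (torusPattern v) (x :: xs ++ ys) l' ↔
      l' = xs.map (fun y => 2 * x - y) ++ x :: ys := by
  subst h
  induction xs using List.reverseRecOn generalizing ys l' with
  | nil => simp [torusPattern, joins_nil]
  | append_singleton xs z ih =>
    have hv : torusPattern ((xs ++ [z]).length + 1) =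
        torusPattern (xs.length + 1) ++ [⟨.slash, xs.length⟩] := by
      simp [torusPattern, List.range_succ]
    have := @ih (z :: ys)
    simp only [List.cons_append] at this
    simp only [hv, joins_append, List.cons_append, List.append_assoc, List.nil_append, this,
      joins_cons, joins_nil, existsAndEq, and_true, true_and,
      Piece.colors_length (List.length_map _), Piece.colors_slash_zero]
    simp

/-- The alternating sum `x 0 - x 1 + ⋯ ± x (u - 1)`. -/
def altSum (x : ℕ → ZMod p) (u : ℕ) : ZMod p := ∑ k ∈ Finset.range u, (-1) ^ k * x k

/-- The colors of the strands `0, …, v - 1` above `k` copies of the pattern, where the colors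
below the first copy are `x 0, …, x (v - 1)` and `x` has period `v`: the strands have been shifted
by `k` places, and the product of the reflections in `x 0, …, x (k - 1)` has been applied
to the colors. -/
def torusColors (v : ℕ) (x : ℕ → ZMod p) (k : ℕ) : List (ZMod p) :=
  (List.range v).map fun j => 2 * altSum x k + (-1) ^ k * x (j + k)

theorem length_torusColors {v k : ℕ} {x : ℕ → ZMod p} : (torusColors v x k).length = v := by
  simp [torusColors]

theorem joins_torusPattern_torusColors {v k : ℕ} {x : ℕ → ZMod p} (hx : ∀ j, x (j + v) = x j)
    (hv : 0 < v) {ys l' : List (ZMod p)} :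
    Joins (torusPattern v) (torusColors v x k ++ ys) l' ↔ l' = torusColors v x (k + 1) ++ ys := by
  obtain ⟨n, rfl⟩ := Nat.exists_eq_add_one.2 hv
  have h1 : torusColors (n + 1) x k = (2 * altSum x k + (-1) ^ k * x k) ::
      (List.range n).map fun j => 2 * altSum x k + (-1) ^ k * x (j + 1 + k) := by
    simp [torusColors, List.range_succ_eq_map, Function.comp_def]
  have h2 : torusColors (n + 1) x (k + 1) = ((List.range n).map fun j =>
      2 * altSum x k + (-1) ^ k * x (j + 1 + k)).map
        (fun y => 2 * (2 * altSum x k + (-1) ^ k * x k) - y) ++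
      [2 * altSum x k + (-1) ^ k * x k] := by
    have h3 : x (n + (k + 1)) = x k := by rw [← hx k]; congr 1; ring
    have h4 : altSum x (k + 1) = altSum x k + (-1) ^ k * x k := Finset.sum_range_succ _ _
    rw [torusColors, List.range_succ, List.map_append, List.map_map, List.map_cons, List.map_nil,
      h3, h4]
    congr 1
    · refine List.map_congr_left fun j _ => ?_
      simp only [Function.comp_apply, show j + (k + 1) = j + 1 + k by ring]
      ring
    · simp only [List.cons.injEq, and_true]; ring
  rw [h1, joins_torusPattern (by simp), h2]
  simp

theorem joins_replicate_torusPattern {v k u : ℕ} {x : ℕ → ZMod p} (hx : ∀ j, x (j + v) = x j)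
    (hv : 0 < v) {ys l' : List (ZMod p)} :
    Joins (List.replicate u (torusPattern v)).flatten (torusColors v x k ++ ys) l' ↔
      l' = torusColors v x (k + u) ++ ys := by
  induction u generalizing k with
  | zero => simp [joins_nil]
  | succ u ih =>
    simp only [List.replicate_succ, List.flatten_cons, joins_append,
      joins_torusPattern_torusColors hx hv, existsAndEq, true_and, ih]
    rw [show k + 1 + u = k + (u + 1) by ring]

theorem exists_eq_torusColors_zero {v : ℕ} {xs : List (ZMod p)} (h : xs.length = v) :
    ∃ x : ℕ → ZMod p, (∀ j, x (j + v) = x j) ∧ xs = torusColors v x 0 := by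
  refine ⟨fun j => xs.getD (j % v) 0, by simp, List.ext_getElem (by simp [torusColors, h]) ?_⟩
  intro i h1 h2
  simp [torusColors, altSum, Nat.mod_eq_of_lt (h ▸ h1), h1]

theorem forall_mem_torusColors_zero {v : ℕ} (hv : 0 < v) {x : ℕ → ZMod p}
    (hx : ∀ j, x (j + v) = x j) {c : ZMod p} :
    (∀ y ∈ torusColors v x 0, y = c) ↔ ∀ j, x j = c := by
  have hmod (j : ℕ) : x (j % v) = x j := Function.Periodic.map_mod_nat hx j
  simp only [torusColors, altSum, Finset.range_zero, Finset.sum_empty, mul_zero, zero_add, pow_zero,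
    one_mul, add_zero, List.mem_map, List.mem_range, forall_exists_index, and_imp,
    forall_apply_eq_imp_iff₂]
  exact ⟨fun h j => hmod j ▸ h _ (Nat.mod_lt j hv), fun h j _ => h j⟩

/-- The colorings of the torus diagram correspond to the sequences of period `v` that its
`u` patterns, as a composition of reflections and a shift, map to themselves. -/
theorem torusLink_isColorable_iff {u v : ℕ} (hv : 0 < v) :
    (torusLink u v).IsColorable p ↔ ∃ x : ℕ → ZMod p, (∀ j, x (j + v) = x j) ∧
      (∀ j, 2 * altSum x u + (-1) ^ u * x (j + u) = x j) ∧ ¬ ∃ c, ∀ j, x j = c := by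
  have closes {x : ℕ → ZMod p} (hx : ∀ j, x (j + v) = x j) :
      Joins ((List.replicate u (torusPattern v)).flatten ++ nestedCaps v)
        (torusColors v x 0 ++ (torusColors v x 0).reverse) [] ↔
      ∀ j, 2 * altSum x u + (-1) ^ u * x (j + u) = x j := by
    have hmod (j : ℕ) : x (j % v) = x j := Function.Periodic.map_mod_nat hx j
    simp only [joins_append, joins_replicate_torusPattern hx hv, existsAndEq, true_and, zero_add]
    rw [joins_nestedCaps length_torusColors (by simp [length_torusColors]), List.reverse_inj]
    simp only [torusColors, altSum, Finset.range_zero, Finset.sum_empty, mul_zero, zero_add,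
      pow_zero, one_mul, add_zero, List.map_inj_left, List.mem_range]
    refine ⟨fun h j => ?_, fun h j _ => (h j).symm⟩
    have := h (j % v) (Nat.mod_lt j hv)
    rw [hmod, ← hmod (j % v + u), Nat.mod_add_mod, hmod] at this
    exact this.symm
  rw [torusLink, LinkDiagram.isColorable_toLink, LinkDiagram.isColorable_iff]
  have hw : torusWord u v =
      nestedCups v ++ ((List.replicate u (torusPattern v)).flatten ++ nestedCaps v) := by
    simp [torusWord]
  simp only [hw]
  constructor
  · rintro ⟨ls, h, hc⟩
    have hT := isTangle_torusWord u v
    obtain ⟨l₁, l₂, rfl, h1, h2⟩ := isColoring_append.1 h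
    obtain ⟨xs, hxs, h3⟩ := joins_nestedCups.1 ⟨l₁, h1, rfl⟩
    obtain ⟨x, hx, rfl⟩ := exists_eq_torusColors_zero hxs
    have hlast : l₂.getLastD (l₁.getLastD []) = [] := by
      rw [hw] at hT
      have := Joins.length_eq (p := p) (joins_append.2 ⟨_, ⟨l₁, h1, rfl⟩, ⟨l₂, h2, rfl⟩⟩) hT
      exact List.length_eq_zero_iff.1 this
    refine ⟨x, hx, (closes hx).1 ⟨l₂, h3 ▸ h2, h3 ▸ hlast⟩, ?_⟩
    rintro ⟨c, h4⟩
    have h5 : ∀ y ∈ l₁.getLastD [], y = c := by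
      rw [h3]
      simpa using (forall_mem_torusColors_zero hv hx).2 h4
    refine hc ⟨c, ?_⟩
    simp only [List.mem_append, or_imp, forall_and]
    refine ⟨(h1.const_down ?_ h5).2, h2.const_up ?_ h5⟩
    · simp [nestedCups]
    · simp only [List.mem_append, List.mem_flatten, List.mem_replicate]
      rintro P (⟨_, ⟨-, rfl⟩, hP⟩ | hP)
      · simp only [torusPattern, List.mem_map] at hP; obtain ⟨_, -, rfl⟩ := hP; simp
      · simp only [nestedCaps, List.mem_map] at hP; obtain ⟨_, -, rfl⟩ := hP; simp
  · rintro ⟨x, hx, h, hc⟩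
    obtain ⟨l₁, h1, h3⟩ :=
      joins_nestedCups.2 ⟨torusColors v x 0, length_torusColors, rfl⟩
    obtain ⟨l₂, h2, -⟩ := (closes hx).2 h
    refine ⟨l₁ ++ l₂, isColoring_append.2 ⟨_, _, rfl, h1, h3 ▸ h2⟩, ?_⟩
    rintro ⟨c, h4⟩
    refine hc ⟨c, (forall_mem_torusColors_zero hv hx).1 fun y hy => ?_⟩
    have hy' : y ∈ l₁.getLastD [] := by rw [h3]; simp [hy]
    rw [List.getLastD_eq_getLast?] at hy'
    cases h' : l₁.getLast? with
    | none => simp [h'] at hy'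
    | some m =>
      exact h4 m (List.mem_append_left _ (List.mem_of_getLast? h')) y (by simpa [h'] using hy')

end Torus

/-! ### Alternating sums and the fixed sequences -/

section Arithmetic

variable {p : ℕ}

theorem altSum_add (x : ℕ → ZMod p) (u w : ℕ) :
    altSum x (u + w) = altSum x u + (-1) ^ u * altSum (fun j => x (j + u)) w := by
  simp only [altSum, Finset.sum_range_add, Finset.mul_sum]
  congr 1
  refine Finset.sum_congr rfl fun k _ => ?_
  rw [pow_add, add_comm u k, mul_assoc]

/-- If a shift by `h` multiplies the sequence by `(-1) ^ h`, then all blocks of length `h`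
contribute the same amount to the alternating sum. -/
theorem altSum_mul {x : ℕ → ZMod p} {h : ℕ} (hx : ∀ j, x (j + h) = (-1) ^ h * x j) (k : ℕ) :
    altSum x (k * h) = k * altSum x h := by
  induction k with
  | zero => simp [altSum]
  | succ k ih =>
    have h1 : altSum (fun j => x (j + h)) (k * h) = (-1) ^ h * altSum x (k * h) := by
      simp only [altSum, Finset.mul_sum, hx]
      exact Finset.sum_congr rfl fun _ _ => by ring
    have h2 : ((-1) ^ h * (-1) ^ h : ZMod p) = 1 := by rw [← mul_pow]; simp
    rw [add_mul, one_mul, add_comm, altSum_add, h1, ← mul_assoc, h2, ih]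
    push_cast
    ring

/-- If the alternating sum over each block vanishes and a shift by a block has the same sign as the
composition of its reflections, then shift and reflections cancel. -/
theorem torusLink_isColorable_of_altSum_eq_zero {x : ℕ → ZMod p} {h v : ℕ} (k : ℕ) (hv : 0 < v)
    (hxv : ∀ j, x (j + v) = x j) (hxh : ∀ j, x (j + h) = (-1) ^ h * x j) (h0 : altSum x h = 0)
    (hc : ¬ ∃ c, ∀ j, x j = c) : (torusLink (k * h) v).IsColorable p := by
  refine (torusLink_isColorable_iff hv).2 ⟨x, hxv, fun j => ?_, hc⟩
  have h1 : ∀ k, x (j + k * h) = (-1) ^ (k * h) * x j := by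
    intro k
    induction k with
    | zero => simp
    | succ k ih => rw [add_mul, one_mul, ← add_assoc, hxh, ih, pow_add]; ring
  rw [altSum_mul hxh, h0, h1, mul_zero, mul_zero, zero_add, ← mul_assoc, ← mul_pow]
  simp

/-- The block `1, 1, 0, …, 0` of length `h`, repeated with the sign `(-1) ^ h`, is not constant
and has alternating sum zero. -/
theorem exists_altSum_eq_zero [Fact (1 < p)] {h : ℕ} (hh : 3 ≤ h) :
    ∃ x : ℕ → ZMod p, (∀ j, x (j + h) = (-1) ^ h * x j) ∧ altSum x h = 0 ∧
      ¬ ∃ c, ∀ j, x j = c := by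
  refine ⟨fun j => (-1) ^ (h * (j / h)) * if j % h ≤ 1 then 1 else 0, fun j => ?_, ?_, ?_⟩
  · simp only [Nat.add_div_right j (show 0 < h by omega), Nat.add_mod_right]
    ring
  · obtain ⟨k, rfl⟩ := Nat.exists_eq_add_of_le (show 2 ≤ h by omega)
    rw [altSum, Finset.sum_range_add, Finset.sum_range_succ, Finset.sum_range_one]
    have h1 : 1 / (2 + k) = 0 := Nat.div_eq_of_lt (by omega)
    have h2 : 1 % (2 + k) = 1 := Nat.mod_eq_of_lt (by omega)
    rw [Finset.sum_eq_zero]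
    · simp [h1, h2]
    · intro i hi
      rw [Nat.mod_eq_of_lt (by simpa using hi), if_neg (by omega)]
      simp
  · rintro ⟨c, hc⟩
    have h1 := (hc 0).trans (hc 2).symm
    simp [Nat.mod_eq_of_lt (show 2 < h by omega)] at h1

/-- The indicator function of the multiples of `n`. -/
theorem exists_periodic_not_const [Fact (1 < p)] {n : ℕ} (hn : 1 < n) :
    ∃ x : ℕ → ZMod p, (∀ j, x (j + n) = x j) ∧ ¬ ∃ c, ∀ j, x j = c := by
  refine ⟨fun j => if n ∣ j then 1 else 0, by simp, ?_⟩
  rintro ⟨c, hc⟩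
  have h1 := (hc 0).trans (hc 1).symm
  simp [show n ≠ 1 by omega] at h1

theorem exists_alternating [Fact (1 < p)] :
    ∃ x : ℕ → ZMod p, (∀ j, x (j + 2) = x j) ∧ (∀ j, x j + x (j + 1) = 1) ∧ x 0 = 1 ∧
      ¬ ∃ c, ∀ j, x j = c := by
  refine ⟨fun j => if Even j then 1 else 0, fun j => by simp [Nat.even_add], fun j => ?_, by simp,
    ?_⟩
  · by_cases h : Even j <;> simp [h, Nat.even_add_one]
  · rintro ⟨c, hc⟩
    have h1 := (hc 0).trans (hc 1).symm
    simp at h1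

theorem apply_add_mul {x : ℕ → ZMod p} {n : ℕ} (hx : ∀ j, x (j + n) = x j) (j k : ℕ) :
    x (j + k * n) = x j := by
  simpa using (Function.Periodic.nsmul (f := x) (c := n) hx k) j

theorem altSum_mul_two {x : ℕ → ZMod p} (hx : ∀ j, x (j + 2) = x j) (k : ℕ) :
    altSum x (k * 2) = k * (x 0 - x 1) := by
  rw [altSum_mul (by simpa using hx)]
  simp [altSum, Finset.sum_range_succ, sub_eq_add_neg]

end Arithmetic

/-! ### Colorability of the torus links -/

section TorusLinks

/-- The shift is trivial here and the product of the reflections is again a reflection, which for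
odd `p` has only one fixed point. -/
theorem torusLink_isNearlyInvisible {q n : ℕ} (hn : 1 < n) (hn' : Odd n) (hq : Odd q) :
    (torusLink (q * n) n).IsNearlyInvisible := by
  intro p hp
  have : Fact p.Prime := ⟨hp⟩
  rw [torusLink_isColorable_iff (by omega)]
  constructor
  · rintro ⟨x, hx, h, hc⟩
    by_contra h2
    have h2' : (2 : ZMod p) ≠ 0 := by
      have := (ZMod.natCast_eq_zero_iff 2 p).not.2 fun h => h2 ((Nat.prime_dvd_prime_iff_eq hp
        Nat.prime_two).1 h)
      exact_mod_cast this
    refine hc ⟨altSum x (q * n), fun j => mul_left_cancel₀ h2' ?_⟩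
    have := h j
    rw [apply_add_mul hx, (hq.mul hn').neg_one_pow] at this
    linear_combination -this
  · rintro rfl
    obtain ⟨x, hx, hc⟩ := exists_periodic_not_const (p := 2) hn
    refine ⟨x, hx, fun j => ?_, hc⟩
    -- In `ZMod 2`, a reflection is the identity.
    rw [apply_add_mul hx, show (2 : ZMod 2) = 0 from rfl, show (-1 : ZMod 2) = 1 from rfl]
    simp

/-- A sequence `x` of period two is a coloring if and only if `m * (x 0 - x 1) = 0`. -/
theorem torusLink_two_isColorable_iff {m p : ℕ} (hp : p.Prime) :
    (torusLink m 2).IsColorable p ↔ p ∣ m := by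
  have : Fact p.Prime := ⟨hp⟩
  rw [torusLink_isColorable_iff two_pos, ← ZMod.natCast_eq_zero_iff]
  obtain ⟨k, hk⟩ := Nat.even_or_odd' m
  rw [mul_comm] at hk
  have odd_sum {x : ℕ → ZMod p} (hx : ∀ j, x (j + 2) = x j) :
      altSum x (k * 2 + 1) = k * (x 0 - x 1) + x 0 := by
    have h1 := apply_add_mul hx 0 k
    rw [zero_add] at h1
    rw [altSum, Finset.sum_range_succ, h1, ← altSum, altSum_mul_two hx]
    simp
  constructor
  · rintro ⟨x, hx, h, hc⟩
    have hne : x 0 - x 1 ≠ 0 := fun h1 => hc ⟨x 0, fun j => by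
      rw [← Function.Periodic.map_mod_nat (f := x) hx j]
      obtain h2 | h2 := Nat.mod_two_eq_zero_or_one j <;> rw [h2]
      exact (sub_eq_zero.1 h1).symm⟩
    refine (mul_eq_zero.1 ?_).resolve_right hne
    have h0 := h 0
    obtain rfl | rfl := hk
    · rw [altSum_mul_two hx, apply_add_mul hx] at h0
      simp only [mul_comm k 2, pow_mul] at h0
      push_cast
      linear_combination h0
    · rw [odd_sum hx, show 0 + (k * 2 + 1) = 1 + k * 2 by ring, apply_add_mul hx] at h0
      simp only [mul_comm k 2, pow_mul, pow_succ] at h0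
      push_cast
      linear_combination h0
  · intro hm
    obtain ⟨x, hx, hx1, hx0, hc⟩ := exists_alternating (p := p)
    refine ⟨x, hx, fun j => ?_, hc⟩
    have h1 := hx1 0
    have hj := hx1 j
    obtain rfl | rfl := hk
    · rw [altSum_mul_two hx, apply_add_mul hx]
      simp only [mul_comm k 2, pow_mul]
      push_cast at hm
      linear_combination hm + 2 * k * (2 * hx0 - h1)
    · rw [odd_sum hx, show j + (k * 2 + 1) = (j + 1) + k * 2 by ring, apply_add_mul hx]
      simp only [mul_comm k 2, pow_mul, pow_succ]
      push_cast at hm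
      linear_combination hm - hj + 2 * k * (2 * hx0 - h1) + 2 * hx0

/-- For odd `p`, a coloring has period two, and the condition becomes `m * (x 0 - x 1) = 0` as for
two strands. For `p = 2`, every sequence of period two is a coloring. -/
theorem torusLink_four_isColorable_iff {m p : ℕ} (hp : p.Prime) (hm : Odd m) :
    (torusLink (m * 2) 4).IsColorable p ↔ p ∣ 2 * m := by
  have : Fact p.Prime := ⟨hp⟩
  rw [torusLink_isColorable_iff four_pos, ← ZMod.natCast_eq_zero_iff]
  have hpow : ((-1) ^ (m * 2) : ZMod p) = 1 := by simp [mul_comm m 2, pow_mul]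
  rw [hpow]
  constructor
  · rintro ⟨x, hx, h, hc⟩
    by_contra hm0
    push_cast at hm0
    have h2 : (2 : ZMod p) ≠ 0 := left_ne_zero_of_mul hm0
    obtain ⟨k, rfl⟩ := hm
    have hu : (2 * k + 1) * 2 = k * 4 + 2 := by ring
    have hS : altSum x (k * 4 + 2) = k * (x 0 - x 1 + x 2 - x 3) + (x 0 - x 1) := by
      rw [altSum_add, altSum_mul (by simpa [show Even 4 by decide] using hx)]
      simp only [apply_add_mul hx]
      simp [altSum, Finset.sum_range_succ, mul_comm k 4, pow_mul]
      ring
    -- For the sum `S` in `hS`, the equations at `0` and `2` give `4 * S = 0`.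
    have hs (j : ℕ) : x (j + (2 * k + 1) * 2) = x (j + 2) := by
      rw [hu, add_comm (k * 4), ← add_assoc, apply_add_mul hx]
    simp only [hs, one_mul] at h
    rw [hu] at h
    have h0 := h 0
    have h1 := h 1
    have h3 := h 2
    rw [show 2 + 2 = 0 + 4 by rfl, hx] at h3
    simp only [zero_add, show 1 + 2 = 3 from rfl] at h0 h1
    have hS0 : altSum x (k * 4 + 2) = 0 := by
      refine (mul_eq_zero.1 ((mul_eq_zero.1 ?_).resolve_left h2)).resolve_left h2
      linear_combination h0 + h3
    rw [hS0] at h0 h1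
    rw [hS0] at hS
    have h01 : x 0 - x 1 = 0 := by
      refine (mul_eq_zero.1 ?_).resolve_left hm0
      push_cast
      linear_combination -2 * hS + 2 * k * (h1 - h0)
    refine hc ⟨x 0, fun j => ?_⟩
    rw [← Function.Periodic.map_mod_nat (f := x) hx j]
    have := Nat.mod_lt j four_pos
    interval_cases j % 4
    · rfl
    · linear_combination -h01
    · linear_combination h0
    · linear_combination h1 - h01
  · intro hm0
    obtain ⟨x, hx, hx1, hx0, hc⟩ := exists_alternating (p := p)
    refine ⟨x, fun j => apply_add_mul hx j 2, fun j => ?_, hc⟩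
    rw [altSum_mul_two hx, apply_add_mul hx]
    push_cast at hm0
    linear_combination hm0 + 2 * m * (2 * hx0 - hx1 0)

/-- The patterns form blocks of length `h`, which is the number
of strands or half of it, and the coloring changes by the sign `(-1) ^ h` from block to block. -/
theorem torusLink_isRainbowRing {k h v : ℕ} (hv : 0 < v) (hh : 3 ≤ h)
    (hvh : v = h ∧ Even h ∨ v = h * 2) : (torusLink (k * h) v).IsRainbowRing := by
  intro p hp
  have : Fact p.Prime := ⟨hp⟩
  obtain ⟨x, hx, h0, hc⟩ := exists_altSum_eq_zero (p := p) hh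
  refine torusLink_isColorable_of_altSum_eq_zero k hv (fun j => ?_) hx h0 hc
  obtain ⟨rfl, he⟩ | rfl := hvh
  · rw [hx, he.neg_one_pow, one_mul]
  · rw [mul_two, ← add_assoc, hx, hx, ← mul_assoc, ← mul_pow]
    simp

/-- Two consecutive full turns contribute opposite alternating sums, so every sequence of
period `n` is a coloring. -/
theorem torusLink_isRainbowRing_of_odd {k n : ℕ} (hn : 1 < n) (hn' : Odd n) :
    (torusLink (k * (n * 2)) n).IsRainbowRing := by
  intro p hp
  have : Fact p.Prime := ⟨hp⟩
  obtain ⟨x, hx, hc⟩ := exists_periodic_not_const (p := p) hn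
  refine torusLink_isColorable_of_altSum_eq_zero k (by omega) hx (fun j => ?_) ?_ hc
  · rw [mul_comm, apply_add_mul hx, pow_mul]
    simp
  · rw [mul_two, altSum_add]
    simp only [hx, hn'.neg_one_pow]
    ring

end TorusLinks

theorem theorem3 (m n : ℕ) (hn : 1 < n) (hmn : Even (m * n)) :
    (Odd n ∧ Odd (m / 2) → (torusLink (m * n / 2) n).IsNearlyInvisible) ∧
    (n = 2 → ∀ p : ℕ, p.Prime → ((torusLink (m * n / 2) n).IsColorable p ↔ p ∣ m)) ∧
    (n = 4 ∧ Odd m →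
      ∀ p : ℕ, p.Prime → ((torusLink (m * n / 2) n).IsColorable p ↔ p ∣ 2 * m)) ∧
    (¬ (Odd n ∧ Odd (m / 2)) ∧ n ≠ 2 ∧ ¬ (n = 4 ∧ Odd m) →
      (torusLink (m * n / 2) n).IsRainbowRing) := by
  have even_left {q : ℕ} : q * 2 * n / 2 = q * n := by
    rw [mul_right_comm, Nat.mul_div_cancel _ two_pos]
  have even_right {h : ℕ} : m * (h * 2) / 2 = m * h := by
    rw [← mul_assoc, Nat.mul_div_cancel _ two_pos]
  refine ⟨?_, ?_, ?_, ?_⟩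
  · rintro ⟨hn', hq⟩
    obtain ⟨q, rfl⟩ : 2 ∣ m := ((Nat.even_mul.1 hmn).resolve_right
      (Nat.not_even_iff_odd.2 hn')).two_dvd
    rw [mul_comm 2 q] at hq ⊢
    rw [Nat.mul_div_cancel _ two_pos] at hq
    rw [even_left]
    exact torusLink_isNearlyInvisible hn hn' hq
  · rintro rfl p hp
    rw [Nat.mul_div_cancel _ two_pos]
    exact torusLink_two_isColorable_iff hp
  · rintro ⟨rfl, hm⟩ p hp
    rw [show 4 = 2 * 2 from rfl, even_right]
    exact torusLink_four_isColorable_iff hp hm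
  · rintro ⟨h1, h2, h4⟩
    obtain hm | hm := Nat.even_or_odd m
    · obtain ⟨q, rfl⟩ := hm.two_dvd
      rw [mul_comm 2 q] at h1 ⊢
      rw [Nat.mul_div_cancel _ two_pos] at h1
      rw [even_left]
      obtain hn' | hn' := Nat.even_or_odd n
      · exact torusLink_isRainbowRing (by omega) (by omega) (.inl ⟨rfl, hn'⟩)
      · obtain ⟨k, rfl⟩ := (Nat.not_odd_iff_even.1 fun hq => h1 ⟨hn', hq⟩).two_dvd
        rw [show 2 * k * n = k * (n * 2) by ring]
        exact torusLink_isRainbowRing_of_odd hn hn'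
    · obtain ⟨h, rfl⟩ := ((Nat.even_mul.1 hmn).resolve_left (Nat.not_even_iff_odd.2 hm)).two_dvd
      have hh : h ≠ 2 := by rintro rfl; exact h4 ⟨rfl, hm⟩
      rw [mul_comm 2 h, even_right]
      exact torusLink_isRainbowRing (by omega) (by omega) (.inr rfl)
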